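/- Let $G$ be a finite group with centre $Z=\mathrm{Z}(G)$, let $\mathrm{Irr}(G)$ be the set of irreducible complex characters of $G$, let $\ker\psi=\{x\in G:\psi(x)=\psi(1)\}$ for $\psi\in\mathrm{Irr}(G)$, let $g^G$ be the conjugacy class of $g\in G$, and regard $\mathrm{Irr}(G/Z)$ as a subset of $\mathrm{Irr}(G)$ by inflation. Let $\chi\in\mathrm{Irr}(G)$ be nonlinear, that is, $\chi(1)\neq 1$. Then the following are equivalent: (1) There is $g\in G\setminus Z$ such that $\chi(g)\neq 0$ and $\chi$ vanishes on every noncentral conjugacy class of $G$ other than $g^G$. (2) $Z\le\ker\chi$, and there is $g\in G\setminus Z$ such that for every $\psi\in\mathrm{Irr}(G)$ with $\psi\neq\chi$: if $\psi\in\mathrm{Irr}(G/Z)$ then $g\in\ker\psi$, and if $\psi\notin\mathrm{Irr}(G/Z)$ then $\psi(g)=0$. Furthermore, if (1) or (2) holds, then for every element $g$ as in (1) and every element $g$ as in (2): - $Z=\ker\chi<G'$ (proper inclusion), where $G'$ is the derived subgroup of $G$; - $\chi(g)=-|Z|\,\chi(1)/|g^G|$, and this is an integer; - $|\mathrm{C}_G(g)|=|\mathrm{C}_{G/Z}(gZ)|$,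 and there is a prime $p$ such that $|\mathrm{C}_G(g)|$ is a power of $p$ and $Z$ is a $p$-group; - $G/Z$ has a unique minimal normal subgroup $M/Z$, and $M\setminus Z$ is a single conjugacy class of $G$. -/

import Mathlib

/-- `Irr G`: the irreducible complex characters of `G`, as functions on `G`. A finite-dimensional
complex representation is given, up to isomorphism, by one on some `ℂⁿ`. -/
def Irr (G : Type*) [Group G] : Set (G → ℂ) :=
  {χ | ∃ (n : ℕ) (ρ : Representation ℂ G (Fin n → ℂ)), ρ.IsIrreducible ∧ ρ.character = χ}

/-- The kernel of a character: `ker χ = {x ∈ G : χ(x) = χ(1)}`. -/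
def charKer {G : Type*} [Group G] (χ : G → ℂ) : Set G :=
  {x | χ x = χ 1}

/-- `Irr(G/N)` viewed as a set of characters of `G`: the inflations to `G` of the irreducible
characters of the quotient group `G ⧸ N`. -/
def inflatedIrr {G : Type*} [Group G] (N : Subgroup G) [N.Normal] : Set (G → ℂ) :=
  {ψ | ∃ φ ∈ Irr (G ⧸ N), ψ = fun x : G => φ (x : G ⧸ N)}

/-- `g` is noncentral, and among the noncentral conjugacy classes of `G`, the class of `g` is the
only one on which `χ` does not vanish. -/
def VanishesOnNoncentralExcept {G : Type*} [Group G] (χ : G → ℂ) (g : G) : Prop :=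
  g ∉ Subgroup.center G ∧ χ g ≠ 0 ∧
    ∀ x : G, x ∉ Subgroup.center G → ¬ IsConj g x → χ x = 0

/-- `g` is noncentral, and every irreducible character `ψ ≠ χ` of `G` has `g` in its kernel if
`ψ ∈ Irr(G/Z(G))`, and vanishes at `g` otherwise. -/
def OthersTrivialOrVanishAt {G : Type*} [Group G] (χ : G → ℂ) (g : G) : Prop :=
  g ∉ Subgroup.center G ∧
    ∀ ψ ∈ Irr G, ψ ≠ χ →
      (ψ ∈ inflatedIrr (Subgroup.center G) → g ∈ charKer ψ) ∧
      (ψ ∉ inflatedIrr (Subgroup.center G) → ψ g = 0)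

/-- `N` is a minimal normal subgroup: minimal among the nontrivial normal subgroups. -/
def IsMinimalNormal {H : Type*} [Group H] (N : Subgroup H) : Prop :=
  Minimal (fun K : Subgroup H => K.Normal ∧ K ≠ ⊥) N

/-- `N` is the unique minimal normal subgroup of `H`. -/
def IsUniqueMinimalNormal {H : Type*} [Group H] (N : Subgroup H) : Prop :=
  IsMinimalNormal N ∧ ∀ K : Subgroup H, IsMinimalNormal K → K = N

/-!
Let `u_S` be the uniform probability density on `S ⊆ G`. For `ψ ∈ Irr G` the pairing of `u_N` with
`ψ`, for `N` normal, is `ψ(1)` if `N ≤ ker ψ` and `0` otherwise, and the pairing of the density of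
the class of `g` with `ψ` is `ψ(g)`. So (2) says that `u_Z - u_{g^G}` is orthogonal to every
`ψ ≠ χ`, that is, a multiple of `χ`; this is (1), once orthogonality of `χ` to the trivial
character has fixed the ratio of its values on `Z` and on `g^G`. Comparing the uniform density on
`M = Z⟪g⟫` with `u_Z` in the same way shows that `M \ Z` is the class of `g`, so `M/Z` is a
`p`-group. For a prime `r ≠ p`, `χ` then vanishes on `R \ Z` for a Sylow `r`-subgroup `R`, so `|R|`
divides `|Z| χ(1)`; together with the norm of `χ` this leaves `p` as the only possible prime divisor
of `|C_G(g)|`.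
-/

section LinearAlgebra

variable {ι K V : Type*} [Field K] [AddCommGroup V] [Module K V]

theorem trace_eq_sum_of_forall_apply_eq_smul [Fintype ι] (b : Module.Basis ι K V)
    {A : Module.End K V} {μ : ι → K} (h : ∀ i, A (b i) = μ i • b i) :
    LinearMap.trace K V A = ∑ i, μ i := by
  classical
  rw [LinearMap.trace_eq_matrix_trace K b, Matrix.trace]
  exact Fintype.sum_congr _ _ fun i => by simp [Matrix.diag, LinearMap.toMatrix_apply, h]

theorem exists_eigenbasis_of_pow_eq_one [IsAlgClosed K] [FiniteDimensional K V]
    {A : Module.End K V} {n : ℕ} (hn : (n : K) ≠ 0) (hA : A ^ n = 1) :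
    ∃ (b : Module.Basis (Fin (Module.finrank K V)) K V) (μ : Fin (Module.finrank K V) → K),
      (∀ i, μ i ^ n = 1) ∧ ∀ i, A (b i) = μ i • b i := by
  classical
  have hss : A.IsSemisimple := Module.End.isSemisimple_of_squarefree_aeval_eq_zero
    (Polynomial.X_pow_sub_one_separable_iff.2 hn).squarefree (by simp [hA])
  have hint : DirectSum.IsInternal A.eigenspace :=
    DirectSum.isInternal_submodule_of_iSupIndep_of_iSup_eq_top A.eigenspaces_iSupIndep
      hss.iSup_eigenspace_eq_top
  let b := hint.collectedBasis fun μ => Module.finBasis K (A.eigenspace μ)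
  have hb : ∀ i, A.HasEigenvector i.1 (b i) := fun i =>
    ⟨hint.collectedBasis_mem _ i, b.ne_zero i⟩
  let e := b.indexEquiv (Module.finBasis K V)
  refine ⟨b.reindex e, fun i => (e.symm i).1, fun i => ?_, fun i => by
    simpa only [Module.Basis.reindex_apply] using (hb (e.symm i)).apply_eq_smul⟩
  refine smul_left_injective K (b.ne_zero (e.symm i)) ?_
  simp only [one_smul, ← (hb (e.symm i)).pow_apply, hA, Module.End.one_apply]

end LinearAlgebra

section Irreducible

variable {G H K V W : Type*} [Monoid G] [Monoid H] [Field K] [AddCommGroup V] [Module K V]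
  [AddCommGroup W] [Module K W]

theorem nontrivial_of_isIrreducible {ρ : Representation K G V} (hρ : ρ.IsIrreducible) :
    Nontrivial V := by
  rw [Representation.irreducible_iff_isSimpleModule_asModule] at hρ
  exact IsSimpleModule.nontrivial (MonoidAlgebra K G) ρ.asModule

theorem isIrreducible_iff_forall_submodule (ρ : Representation K G V) :
    ρ.IsIrreducible ↔ Nontrivial V ∧
      ∀ U : Submodule K V, (∀ g, ∀ v ∈ U, ρ g v ∈ U) → U = ⊥ ∨ U = ⊤ := by
  constructor
  · refine fun hρ => ⟨nontrivial_of_isIrreducible hρ, fun U hU => ?_⟩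
    exact (hρ.eq_bot_or_eq_top ⟨U, hU⟩).imp (congrArg Subrepresentation.toSubmodule)
      (congrArg Subrepresentation.toSubmodule)
  · rintro ⟨hV, h⟩
    exact
      { exists_pair_ne := ⟨⊥, ⊤, fun e =>
          bot_ne_top (α := Submodule K V) (congrArg Subrepresentation.toSubmodule e)⟩
        eq_bot_or_eq_top := fun U =>
          (h U.toSubmodule fun g _ hv => U.apply_mem_toSubmodule g hv).imp
            (Subrepresentation.toSubmodule_injective ·)
            (Subrepresentation.toSubmodule_injective ·) }

theorem isIrreducible_comp_iff {f : G →* H} (hf : Function.Surjective f)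
    (ρ : Representation K H V) :
    Representation.IsIrreducible (ρ.comp f) ↔ ρ.IsIrreducible := by
  simp only [isIrreducible_iff_forall_submodule, MonoidHom.comp_apply, hf.forall]

theorem isIrreducible_of_equiv {ρ : Representation K G V} {σ : Representation K G W}
    (e : ρ.Equiv σ) (hρ : ρ.IsIrreducible) : σ.IsIrreducible := by
  rw [Representation.irreducible_iff_isSimpleModule_asModule] at hρ ⊢
  exact IsSimpleModule.congr (LinearEquiv.ofBijective
    (Representation.IntertwiningMap.equivLinearMapAsModule σ ρ e.symm.toIntertwiningMap)
    (EquivLike.bijective e.symm))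

theorem exists_eq_smul_one_of_isIrreducible [IsAlgClosed K] [FiniteDimensional K V]
    {ρ : Representation K G V} (hρ : ρ.IsIrreducible) {A : Module.End K V}
    (hA : ∀ g, Commute A (ρ g)) : ∃ c : K, A = c • 1 := by
  let f : Representation.IntertwiningMap ρ ρ := ⟨A, fun g => (hA g).eq⟩
  obtain ⟨c, hc⟩ :=
    Representation.IsIrreducible.algebraMap_intertwiningMap_bijective_of_isAlgClosed.2 f
  exact ⟨c, congrArg Representation.IntertwiningMap.toLinearMap hc.symm⟩

theorem isIrreducible_ofModule' (M : Type*) [AddCommGroup M] [Module K M]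
    [Module (MonoidAlgebra K G) M] [IsScalarTower K (MonoidAlgebra K G) M]
    [IsSimpleModule (MonoidAlgebra K G) M] :
    (Representation.ofModule' (k := K) (G := G) M).IsIrreducible := by
  refine (isIrreducible_iff_forall_submodule _).2
    ⟨IsSimpleModule.nontrivial (MonoidAlgebra K G) M, fun U hU => ?_⟩
  have hsmul : ∀ g, ∀ v ∈ U, MonoidAlgebra.of K G g • v ∈ U := hU
  have hcoe : ∀ v, v ∈ MonoidAlgebra.submoduleOfSMulMem U hsmul ↔ v ∈ U := fun v => Iff.rfl
  refine (eq_bot_or_eq_top (MonoidAlgebra.submoduleOfSMulMem U hsmul)).imp (fun h => ?_)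
    fun h => ?_ <;> ext v <;> simp [← hcoe, h]

end Irreducible

section Character

variable {G V : Type*} [Group G] [AddCommGroup V] [Module ℂ V] [FiniteDimensional ℂ V]
  (ρ : Representation ℂ G V)

theorem character_mem_Irr {ρ : Representation ℂ G V} (hρ : ρ.IsIrreducible) :
    ρ.character ∈ Irr G := by
  let e := (Module.finBasis ℂ V).equivFun
  let σ : Representation ℂ G (Fin (Module.finrank ℂ V) → ℂ) :=
    (e.conjRingEquiv : _ →* _).comp ρ
  have eqv : ρ.Equiv σ := .mk e fun g => by ext v; simp [σ, LinearEquiv.conjRingEquiv]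
  exact ⟨_, σ, isIrreducible_of_equiv eqv hρ, (Representation.char_iso eqv).symm⟩

variable [Finite G]

theorem exists_eigenbasis_apply (x : G) :
    ∃ (b : Module.Basis (Fin (Module.finrank ℂ V)) ℂ V) (μ : Fin (Module.finrank ℂ V) → ℂ),
      (∀ i, μ i ^ Nat.card G = 1) ∧ ∀ i, ρ x (b i) = μ i • b i :=
  exists_eigenbasis_of_pow_eq_one (Nat.cast_ne_zero.2 Nat.card_pos.ne')
    (by rw [← map_pow, pow_card_eq_one', map_one])

theorem character_inv (x : G) : ρ.character x⁻¹ = star (ρ.character x) := by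
  obtain ⟨b, μ, hμ, hb⟩ := exists_eigenbasis_apply ρ x
  have hμ1 : ∀ i, ‖μ i‖ = 1 := fun i => Complex.norm_eq_one_of_pow_eq_one (hμ i) Nat.card_pos.ne'
  have hinv : ∀ i, ρ x⁻¹ (b i) = star (μ i) • b i := fun i => by
    rw [Representation.inv_apply_eq_iff, map_smul, hb, smul_smul, Complex.star_def,
      ← Complex.inv_eq_conj (hμ1 i), inv_mul_cancel₀ (norm_ne_zero_iff.1 (by simp [hμ1])), one_smul]
  rw [Representation.character, Representation.character,
    trace_eq_sum_of_forall_apply_eq_smul b hb, trace_eq_sum_of_forall_apply_eq_smul b hinv,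
    star_sum]

theorem isIntegral_character (x : G) : IsIntegral ℤ (ρ.character x) := by
  obtain ⟨b, μ, hμ, hb⟩ := exists_eigenbasis_apply ρ x
  rw [Representation.character, trace_eq_sum_of_forall_apply_eq_smul b hb]
  exact IsIntegral.sum _ fun i _ => .of_pow Nat.card_pos (hμ i ▸ isIntegral_one)

theorem charKer_character : charKer ρ.character = ρ.ker := by
  ext x
  rw [SetLike.mem_coe, MonoidHom.mem_ker]
  refine ⟨fun hx => ?_, fun hx => by simp [charKer, Representation.character, hx]⟩
  obtain ⟨b, μ, hμ, hb⟩ := exists_eigenbasis_apply ρ x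
  have hμ1 : ∀ i, ‖μ i‖ = 1 := fun i => Complex.norm_eq_one_of_pow_eq_one (hμ i) Nat.card_pos.ne'
  have hre : ∀ i, 0 ≤ 1 - (μ i).re := fun i =>
    sub_nonneg.2 ((Complex.re_le_norm _).trans_eq (hμ1 i))
  have hsum : ∑ i, μ i = Module.finrank ℂ V := by
    rw [← trace_eq_sum_of_forall_apply_eq_smul b hb, ← ρ.char_one]
    exact hx
  have hzero : ∑ i, (1 - (μ i).re) = 0 := by
    simp [← Complex.re_sum, hsum]
  have hone : ∀ i, μ i = 1 := fun i => by
    have hi : (μ i).re = 1 :=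
      (sub_eq_zero.1 ((Finset.sum_eq_zero_iff_of_nonneg fun i _ => hre i).1 hzero i
        (Finset.mem_univ i))).symm
    exact Complex.ext hi (Complex.abs_re_eq_norm.1 (by rw [hi, hμ1, abs_one]))
  exact b.ext fun i => by rw [hb, hone, one_smul, Module.End.one_apply]

end Character

section ClassFunction

variable {G : Type*} [Group G]

/-- A class function: constant on conjugacy classes. -/
def IsClassFunction (f : G → ℂ) : Prop :=
  ∀ ⦃x y : G⦄, IsConj x y → f x = f y

variable {f : G → ℂ}

theorem IsClassFunction.commute_sum_smul [Fintype G] (hf : IsClassFunction f) {V : Type*}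
    [AddCommGroup V] [Module ℂ V] (ρ : Representation ℂ G V) (g : G) :
    Commute (∑ x, f x • ρ x⁻¹) (ρ g) := by
  rw [Commute, SemiconjBy, Finset.sum_mul, Finset.mul_sum]
  refine Fintype.sum_equiv (MulAut.conj g⁻¹).toEquiv _ _ fun x => ?_
  have hx : f (g⁻¹ * (x * g)) = f x := (hf (isConj_iff.2 ⟨g⁻¹, by group⟩)).symm
  simp [hx, ← map_mul, mul_assoc]

variable [Fintype G]

theorem IsClassFunction.sum_smul_eq_zero_of_isIrreducible (hf : IsClassFunction f)
    (horth : ∀ ψ ∈ Irr G, f ⬝ᵥ star ψ = 0) {V : Type*} [AddCommGroup V] [Module ℂ V]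
    [FiniteDimensional ℂ V] {ρ : Representation ℂ G V} (hρ : ρ.IsIrreducible) :
    ∑ x, f x • ρ x⁻¹ = 0 := by
  obtain ⟨c, hc⟩ := exists_eq_smul_one_of_isIrreducible hρ (hf.commute_sum_smul ρ)
  have htrace : c * Module.finrank ℂ V = 0 := calc
    c * Module.finrank ℂ V = LinearMap.trace ℂ V (∑ x, f x • ρ x⁻¹) := by
      rw [hc, map_smul, LinearMap.trace_one, smul_eq_mul]
    _ = ∑ x, f x * ρ.character x⁻¹ := by
      simp only [map_sum, map_smul, smul_eq_mul, Representation.character]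
    _ = f ⬝ᵥ star ρ.character := by simp only [character_inv, dotProduct, Pi.star_apply]
    _ = 0 := horth _ (character_mem_Irr hρ)
  have := nontrivial_of_isIrreducible hρ
  have hdim : (Module.finrank ℂ V : ℂ) ≠ 0 := Nat.cast_ne_zero.2 Module.finrank_pos.ne'
  rw [hc, (mul_eq_zero.1 htrace).resolve_right hdim, zero_smul]

/-- The element `∑ f(x) x⁻¹` of the semisimple ring `ℂ[G]` acts as zero on every simple module. -/
theorem IsClassFunction.eq_zero_of_forall_dotProduct_eq_zero (hf : IsClassFunction f)
    (horth : ∀ ψ ∈ Irr G, f ⬝ᵥ star ψ = 0) : f = 0 := by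
  have : NeZero (Nat.card G : ℂ) := ⟨Nat.cast_ne_zero.2 Nat.card_pos.ne'⟩
  let a : MonoidAlgebra ℂ G := ∑ x, f x • MonoidAlgebra.of ℂ G x⁻¹
  have hmem : a ∈ Module.jacobson (MonoidAlgebra ℂ G) (MonoidAlgebra ℂ G) := by
    refine Submodule.mem_sInf.2 fun I hI => ?_
    have hsimple : IsSimpleModule (MonoidAlgebra ℂ G) (MonoidAlgebra ℂ G ⧸ I) :=
      isSimpleModule_iff_isCoatom.2 hI
    have hzero := LinearMap.congr_fun (hf.sum_smul_eq_zero_of_isIrreducible horth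
      (isIrreducible_ofModule' (MonoidAlgebra ℂ G ⧸ I))) (Submodule.Quotient.mk 1)
    have ha : a • (Submodule.Quotient.mk 1 : MonoidAlgebra ℂ G ⧸ I) = 0 := by
      simp only [LinearMap.sum_apply, LinearMap.smul_apply] at hzero
      simp only [a, Finset.sum_smul, smul_assoc]
      exact hzero
    rwa [← Submodule.Quotient.mk_smul, smul_eq_mul, mul_one, Submodule.Quotient.mk_eq_zero] at ha
  have ha : a = 0 := by
    rwa [IsSemisimpleModule.jacobson_eq_bot (MonoidAlgebra ℂ G) (MonoidAlgebra ℂ G),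
      Submodule.mem_bot] at hmem
  ext x
  have hx := congrArg (fun b => MonoidAlgebra.coeff b x⁻¹) ha
  classical
  simpa [a, MonoidAlgebra.coeff_sum, Finsupp.finsetSum_apply, Finsupp.single_apply] using hx

end ClassFunction

section Irr

variable {G : Type*} [Group G] {ψ χ : G → ℂ}

theorem Irr.isClassFunction (hψ : ψ ∈ Irr G) : IsClassFunction ψ := by
  obtain ⟨n, ρ, -, rfl⟩ := hψ
  intro x y h
  obtain ⟨c, rfl⟩ := isConj_iff.1 h
  exact (ρ.char_conj x c).symm

theorem Irr.exists_natCast_eq_apply_one (hψ : ψ ∈ Irr G) : ∃ d : ℕ, 0 < d ∧ ψ 1 = d := by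
  obtain ⟨n, ρ, hρ, rfl⟩ := hψ
  have := nontrivial_of_isIrreducible hρ
  exact ⟨_, Module.finrank_pos (R := ℂ) (M := Fin n → ℂ), ρ.char_one⟩

theorem Irr.apply_one_ne_zero (hψ : ψ ∈ Irr G) : ψ 1 ≠ 0 := by
  obtain ⟨d, hd, h⟩ := Irr.exists_natCast_eq_apply_one hψ
  exact h ▸ Nat.cast_ne_zero.2 hd.ne'

theorem Irr.coe_monoidHom_mem (f : G →* ℂˣ) : (fun x => (f x : ℂ)) ∈ Irr G := by
  let ρ : Representation ℂ G ℂ :=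
    ((algebraMap ℂ (Module.End ℂ ℂ) : ℂ →* _).comp (Units.coeHom ℂ)).comp f
  have hρ : ρ.IsIrreducible :=
    (isIrreducible_iff_forall_submodule ρ).2 ⟨inferInstance, fun U _ => eq_bot_or_eq_top U⟩
  convert character_mem_Irr hρ using 1
  ext x
  simp [Representation.character, ρ, Algebra.algebraMap_eq_smul_one]

theorem Irr.one_mem : (1 : G → ℂ) ∈ Irr G :=
  Irr.coe_monoidHom_mem 1

section Finite

variable [Finite G]

theorem Irr.isIntegral_apply (hψ : ψ ∈ Irr G) (x : G) : IsIntegral ℤ (ψ x) := by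
  obtain ⟨n, ρ, -, rfl⟩ := hψ
  exact isIntegral_character ρ x

theorem Irr.exists_normal_eq_charKer (hψ : ψ ∈ Irr G) :
    ∃ K : Subgroup G, K.Normal ∧ (K : Set G) = charKer ψ ∧ ∀ k ∈ K, ∀ x, ψ (k * x) = ψ x := by
  obtain ⟨n, ρ, -, rfl⟩ := hψ
  refine ⟨ρ.ker, inferInstance, (charKer_character ρ).symm, fun k hk x => ?_⟩
  simp [Representation.character, MonoidHom.mem_ker.1 hk]

theorem Irr.mem_inflatedIrr_iff (hψ : ψ ∈ Irr G) (N : Subgroup G) [N.Normal] :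
    ψ ∈ inflatedIrr N ↔ (N : Set G) ⊆ charKer ψ := by
  constructor
  · rintro ⟨φ, -, rfl⟩ x hx
    simp [charKer, (QuotientGroup.eq_one_iff x).2 hx]
  · intro h
    obtain ⟨n, ρ, hρ, rfl⟩ := hψ
    rw [charKer_character, SetLike.coe_subset_coe] at h
    exact ⟨_, ⟨n, QuotientGroup.lift N ρ h,
      (isIrreducible_comp_iff (QuotientGroup.mk'_surjective N) _).1 hρ, rfl⟩, rfl⟩

/-- By Schur's lemma `∑_{n ∈ N} n` acts as a scalar, and it absorbs every `n ∈ N`. -/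
theorem Irr.sum_subgroup_eq_zero (hψ : ψ ∈ Irr G) (N : Subgroup G) [Fintype N] [N.Normal]
    (hN : ¬ (N : Set G) ⊆ charKer ψ) : ∑ n : N, ψ n = 0 := by
  obtain ⟨k, ρ, hρ, rfl⟩ := hψ
  let σ : Representation ℂ N (Fin k → ℂ) := ρ.comp N.subtype
  obtain ⟨c, hc⟩ := exists_eq_smul_one_of_isIrreducible hρ (A := σ.norm) fun g => by
    rw [Commute, SemiconjBy, Representation.norm, Finset.sum_mul, Finset.mul_sum]
    refine Fintype.sum_equiv (MulAut.conjNormal g⁻¹).toEquiv _ _ fun x => ?_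
    simp [σ, ← map_mul, mul_assoc]
  have hc0 : c = 0 := by
    by_contra hc0
    refine hN ?_
    rw [charKer_character, SetLike.coe_subset_coe]
    refine fun n hn => LinearMap.ext fun v => smul_right_injective _ hc0 ?_
    have hv := σ.self_norm_apply ⟨n, hn⟩ v
    rwa [hc, LinearMap.smul_apply, map_smul] at hv
  calc ∑ n : N, ρ.character n = LinearMap.trace ℂ _ σ.norm := by
        simp [Representation.norm, Representation.character, σ]
    _ = 0 := by rw [hc, hc0, zero_smul, map_zero]

theorem Irr.exists_natCast_mul_eq_sum_subgroup (hψ : ψ ∈ Irr G) (R : Subgroup G) [Fintype R] :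
    ∃ k : ℕ, ∑ x : R, ψ x = k * Nat.card R := by
  obtain ⟨n, ρ, -, rfl⟩ := hψ
  let σ : Representation ℂ R (Fin n → ℂ) := ρ.comp R.subtype
  have hR : (Nat.card R : ℂ) ≠ 0 := Nat.cast_ne_zero.2 Nat.card_pos.ne'
  let _ : Invertible (Nat.card R : ℂ) := invertibleOfNonzero hR
  have h := σ.card_inv_mul_sum_char_eq_finrank
  exact ⟨_, by rw [mul_comm, ← h, mul_inv_cancel_left₀ hR]; rfl⟩

end Finite

variable [Fintype G]

theorem Irr.dotProduct_star_self (hψ : ψ ∈ Irr G) : ψ ⬝ᵥ star ψ = Nat.card G := by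
  classical
  obtain ⟨n, ρ, hρ, rfl⟩ := hψ
  let _ : Invertible (Nat.card G : ℂ) := invertibleOfNonzero (Nat.cast_ne_zero.2 Nat.card_pos.ne')
  have h := ρ.char_orthonormal ρ
  rw [if_pos ⟨.refl ρ⟩, inv_mul_eq_one₀ (Nat.cast_ne_zero.2 Nat.card_pos.ne')] at h
  simpa [dotProduct, character_inv] using h.symm

theorem Irr.dotProduct_star_of_ne (hψ : ψ ∈ Irr G) (hχ : χ ∈ Irr G) (hne : ψ ≠ χ) :
    ψ ⬝ᵥ star χ = 0 := by
  classical
  obtain ⟨n, ρ, hρ, rfl⟩ := hψ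
  obtain ⟨m, σ, hσ, rfl⟩ := hχ
  let _ : Invertible (Nat.card G : ℂ) := invertibleOfNonzero (Nat.cast_ne_zero.2 Nat.card_pos.ne')
  have h := ρ.char_orthonormal σ
  rw [if_neg (fun ⟨e⟩ => hne (Representation.char_iso e).symm)] at h
  simpa [dotProduct, character_inv] using h

/-- Subtract from `f` its projection to `χ`. -/
theorem IsClassFunction.exists_eq_smul {f : G → ℂ} (hf : IsClassFunction f) (hχ : χ ∈ Irr G)
    (horth : ∀ ψ ∈ Irr G, ψ ≠ χ → f ⬝ᵥ star ψ = 0) : ∃ t : ℂ, f = t • χ := by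
  refine ⟨(f ⬝ᵥ star χ) / Nat.card G, sub_eq_zero.1 ?_⟩
  refine IsClassFunction.eq_zero_of_forall_dotProduct_eq_zero (fun x y h => ?_) fun ψ hψ => ?_
  · simp [hf h, Irr.isClassFunction hχ h]
  · rw [sub_dotProduct, smul_dotProduct, smul_eq_mul]
    rcases eq_or_ne ψ χ with rfl | hne
    · rw [Irr.dotProduct_star_self hψ, div_mul_cancel₀ _ (Nat.cast_ne_zero.2 Nat.card_pos.ne'),
        sub_self]
    · rw [horth ψ hψ hne, Irr.dotProduct_star_of_ne hχ hψ hne.symm, mul_zero, sub_zero]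

end Irr

section UniformDensity

variable {G : Type*}

/-- The density of the uniform distribution on a finite set `S`; dot products with it are averages
over `S`. -/
noncomputable def uniformDensity (S : Set G) : G → ℂ :=
  S.indicator fun _ => (Nat.card S : ℂ)⁻¹

theorem uniformDensity_of_mem {S : Set G} {x : G} (hx : x ∈ S) :
    uniformDensity S x = (Nat.card S : ℂ)⁻¹ :=
  Set.indicator_of_mem hx _

theorem uniformDensity_of_notMem {S : Set G} {x : G} (hx : x ∉ S) : uniformDensity S x = 0 :=
  Set.indicator_of_notMem hx _

theorem indicator_dotProduct [Fintype G] (S : Set G) [Fintype S] (f h : G → ℂ) :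
    S.indicator f ⬝ᵥ h = ∑ x : S, f x * h x := by
  classical
  simp only [dotProduct, Set.indicator_apply, ite_mul, zero_mul]
  rw [Finset.sum_set_coe (f := fun x => f x * h x), ← Finset.sum_filter,
    Set.filter_mem_univ_eq_toFinset]

theorem uniformDensity_dotProduct_of_forall_eq [Fintype G] {S : Set G} (hS : S.Nonempty)
    {f : G → ℂ} {c : ℂ} (hf : ∀ x ∈ S, f x = c) : uniformDensity S ⬝ᵥ f = c := by
  classical
  have := hS.to_subtype
  have hcard : (Nat.card S : ℂ) ≠ 0 := Nat.cast_ne_zero.2 Nat.card_pos.ne'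
  rw [uniformDensity, indicator_dotProduct, Fintype.sum_congr _ _ fun x => by rw [hf x x.2]]
  rw [Finset.sum_const, Finset.card_univ, ← Nat.card_eq_fintype_card, nsmul_eq_mul,
    mul_inv_cancel_left₀ hcard]

variable [Group G]

theorem isClassFunction_uniformDensity {S : Set G} (hS : ∀ x y, IsConj x y → x ∈ S → y ∈ S) :
    IsClassFunction (uniformDensity S) := by
  intro x y h
  by_cases hx : x ∈ S
  · rw [uniformDensity_of_mem hx, uniformDensity_of_mem (hS x y h hx)]
  · rw [uniformDensity_of_notMem hx, uniformDensity_of_notMem (hx <| hS y x h.symm ·)]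

theorem isClassFunction_uniformDensity_conjugatesOf (g : G) :
    IsClassFunction (uniformDensity (conjugatesOf g)) :=
  isClassFunction_uniformDensity fun _ _ h hx => hx.trans h

theorem mem_of_isConj {N : Subgroup G} [hN : N.Normal] {x y : G} (h : IsConj x y) (hx : x ∈ N) :
    y ∈ N := by
  obtain ⟨c, rfl⟩ := isConj_iff.1 h
  exact hN.conj_mem x hx c

theorem isClassFunction_uniformDensity_normal (N : Subgroup G) [N.Normal] :
    IsClassFunction (uniformDensity (N : Set G)) :=
  isClassFunction_uniformDensity fun _ _ => mem_of_isConj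

theorem IsClassFunction.sub {f h : G → ℂ} (hf : IsClassFunction f) (hh : IsClassFunction h) :
    IsClassFunction (f - h) := fun x y hxy => by
  rw [Pi.sub_apply, Pi.sub_apply, hf hxy, hh hxy]

variable [Fintype G] {ψ : G → ℂ}

theorem IsClassFunction.uniformDensity_conjugatesOf_dotProduct (hψ : IsClassFunction ψ) (g : G) :
    uniformDensity (conjugatesOf g) ⬝ᵥ star ψ = star (ψ g) :=
  uniformDensity_dotProduct_of_forall_eq ⟨g, mem_conjugatesOf_self⟩ fun x hx => by
    rw [Pi.star_apply, hψ hx]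

theorem uniformDensity_dotProduct_of_subset_charKer {N : Subgroup G}
    (hN : (N : Set G) ⊆ charKer ψ) :
    uniformDensity (N : Set G) ⬝ᵥ star ψ = star (ψ 1) :=
  uniformDensity_dotProduct_of_forall_eq ⟨1, N.one_mem⟩ fun x hx => by
    rw [Pi.star_apply, hN hx]

theorem Irr.uniformDensity_dotProduct_of_not_subset_charKer (hψ : ψ ∈ Irr G) {N : Subgroup G}
    [N.Normal] (hN : ¬ (N : Set G) ⊆ charKer ψ) :
    uniformDensity (N : Set G) ⬝ᵥ star ψ = 0 := by
  classical
  calc uniformDensity (N : Set G) ⬝ᵥ star ψ = (Nat.card N : ℂ)⁻¹ * star (∑ n : N, ψ n) := by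
        rw [uniformDensity, indicator_dotProduct, ← Finset.mul_sum, star_sum]
        rfl
    _ = 0 := by rw [Irr.sum_subgroup_eq_zero hψ N hN, star_zero, mul_zero]

end UniformDensity

section CenterMinusClass

variable {G : Type*} [Group G] {χ ψ : G → ℂ} {g : G}

/-- `χ` is a multiple of the uniform density on `Z(G)` minus the uniform density on the class of
a noncentral element `g`. This is the common form of conditions (1) and (2); the scalar is the one
forced by evaluation at `1`. -/
def IsCenterMinusClass (χ : G → ℂ) (g : G) : Prop :=
  g ∉ Subgroup.center G ∧ χ = (χ 1 * Nat.card (Subgroup.center G)) •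
    (uniformDensity (Subgroup.center G : Set G) - uniformDensity (conjugatesOf g))

theorem notMem_conjugatesOf {N : Subgroup G} [N.Normal] {x : G} (hg : g ∉ N) (hx : x ∈ N) :
    x ∉ conjugatesOf g :=
  fun h => hg (mem_of_isConj h.symm hx)

theorem natCard_conjugatesOf_pos [Finite G] (g : G) : 0 < Nat.card (conjugatesOf g) :=
  have : Nonempty (conjugatesOf g) := ⟨⟨g, mem_conjugatesOf_self⟩⟩
  Nat.card_pos

theorem natCast_natCard_conjugatesOf_ne_zero [Finite G] (g : G) :
    (Nat.card (conjugatesOf g) : ℂ) ≠ 0 :=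
  Nat.cast_ne_zero.2 (natCard_conjugatesOf_pos g).ne'

theorem natCast_natCard_subgroup_ne_zero [Finite G] (N : Subgroup G) : (Nat.card N : ℂ) ≠ 0 :=
  Nat.cast_ne_zero.2 Nat.card_pos.ne'

theorem uniformDensity_subgroup_of_mem {N : Subgroup G} {x : G} (hx : x ∈ N) :
    uniformDensity (N : Set G) x = (Nat.card N : ℂ)⁻¹ :=
  uniformDensity_of_mem hx

namespace IsCenterMinusClass

theorem apply_eq (h : IsCenterMinusClass χ g) (x : G) :
    χ x = χ 1 * Nat.card (Subgroup.center G) *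
      (uniformDensity (Subgroup.center G : Set G) x - uniformDensity (conjugatesOf g) x) :=
  congrFun h.2 x

theorem apply_of_mem_center [Finite G] (h : IsCenterMinusClass χ g) {x : G}
    (hx : x ∈ Subgroup.center G) : χ x = χ 1 := by
  rw [h.apply_eq x, uniformDensity_subgroup_of_mem hx,
    uniformDensity_of_notMem (notMem_conjugatesOf h.1 hx), sub_zero,
    mul_inv_cancel_right₀ (natCast_natCard_subgroup_ne_zero _)]

theorem apply_of_isConj (h : IsCenterMinusClass χ g) {x : G} (hx : IsConj g x) :
    χ x = -(Nat.card (Subgroup.center G) * χ 1 / Nat.card (conjugatesOf g)) := by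
  rw [h.apply_eq x, uniformDensity_of_mem (S := conjugatesOf g) hx,
    uniformDensity_of_notMem fun hxZ => notMem_conjugatesOf h.1 hxZ hx]
  ring

theorem apply_eq_zero (h : IsCenterMinusClass χ g) {x : G} (hxZ : x ∉ Subgroup.center G)
    (hx : ¬ IsConj g x) : χ x = 0 := by
  rw [h.apply_eq x, uniformDensity_of_notMem (S := conjugatesOf g) hx,
    uniformDensity_of_notMem hxZ, sub_zero, mul_zero]

theorem apply_ne_zero [Finite G] (h : IsCenterMinusClass χ g) (hχ : χ ∈ Irr G) : χ g ≠ 0 := by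
  rw [h.apply_of_isConj (IsConj.refl g)]
  exact neg_ne_zero.2 <| div_ne_zero
    (mul_ne_zero (natCast_natCard_subgroup_ne_zero _) (Irr.apply_one_ne_zero hχ))
    (natCast_natCard_conjugatesOf_ne_zero g)

theorem vanishesOnNoncentralExcept [Finite G] (h : IsCenterMinusClass χ g) (hχ : χ ∈ Irr G) :
    VanishesOnNoncentralExcept χ g :=
  ⟨h.1, h.apply_ne_zero hχ, fun _ => h.apply_eq_zero⟩

end IsCenterMinusClass

/-- Pair `χ` with the trivial character. -/
theorem VanishesOnNoncentralExcept.sum_center [Finite G] [Fintype (Subgroup.center G)]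
    (h : VanishesOnNoncentralExcept χ g) (hχ : χ ∈ Irr G) (hne : χ ≠ 1) :
    ∑ z : Subgroup.center G, χ z = -(Nat.card (conjugatesOf g) * χ g) := by
  classical
  have := Fintype.ofFinite G
  have hsplit : (Subgroup.center G : Set G).indicator χ + (conjugatesOf g).indicator χ = χ := by
    refine (Set.indicator_union_of_disjoint
      (Set.disjoint_left.2 fun _ => notMem_conjugatesOf h.1) χ).symm.trans ?_
    rw [Set.indicator_eq_self]
    exact fun x hx => or_iff_not_imp_left.2 fun hxZ => not_imp_comm.1 (h.2.2 x hxZ) hx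
  have hclass : ∑ x : conjugatesOf g, χ x = Nat.card (conjugatesOf g) * χ g := by
    rw [Fintype.sum_congr _ _ fun x => (Irr.isClassFunction hχ x.2).symm, Finset.sum_const,
      Finset.card_univ, ← Nat.card_eq_fintype_card, nsmul_eq_mul]
  have horth : χ ⬝ᵥ 1 = 0 := by simpa using Irr.dotProduct_star_of_ne hχ Irr.one_mem hne
  rw [← hsplit, add_dotProduct, indicator_dotProduct, indicator_dotProduct] at horth
  simp only [Pi.one_apply, mul_one, hclass] at horth
  exact eq_neg_of_add_eq_zero_left horth

theorem VanishesOnNoncentralExcept.isCenterMinusClass [Finite G]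
    (h : VanishesOnNoncentralExcept χ g) (hχ : χ ∈ Irr G) (hne : χ ≠ 1) :
    IsCenterMinusClass χ g := by
  have := Fintype.ofFinite (Subgroup.center G)
  have hsum := h.sum_center hχ hne
  have hcl := natCast_natCard_conjugatesOf_ne_zero g
  have hZ : ∀ z ∈ Subgroup.center G, χ z = χ 1 := by
    by_contra hZ
    rw [Irr.sum_subgroup_eq_zero hχ _ hZ, zero_eq_neg] at hsum
    exact mul_ne_zero hcl h.2.1 hsum
  have hg : χ 1 * Nat.card (Subgroup.center G) = -(Nat.card (conjugatesOf g) * χ g) := by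
    rw [← hsum, Fintype.sum_congr _ _ fun z : Subgroup.center G => hZ z z.2, Finset.sum_const,
      Finset.card_univ, ← Nat.card_eq_fintype_card, nsmul_eq_mul, mul_comm]
  refine ⟨h.1, funext fun x => ?_⟩
  rw [Pi.smul_apply, Pi.sub_apply, smul_eq_mul]
  by_cases hx : x ∈ Subgroup.center G
  · rw [uniformDensity_subgroup_of_mem hx,
      uniformDensity_of_notMem (notMem_conjugatesOf h.1 hx), sub_zero,
      mul_inv_cancel_right₀ (natCast_natCard_subgroup_ne_zero _), hZ x hx]
  · rw [uniformDensity_of_notMem hx]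
    by_cases hgx : IsConj g x
    · rw [uniformDensity_of_mem (S := conjugatesOf g) hgx, hg, ← Irr.isClassFunction hχ hgx]
      field_simp
      ring
    · rw [uniformDensity_of_notMem (S := conjugatesOf g) hgx, sub_zero, mul_zero, h.2.2 x hx hgx]

theorem Irr.uniformDensity_sub_dotProduct_eq_zero_iff [Fintype G] (hψ : ψ ∈ Irr G)
    (N : Subgroup G) [N.Normal] (g : G) :
    (uniformDensity (N : Set G) - uniformDensity (conjugatesOf g)) ⬝ᵥ star ψ = 0 ↔
      (ψ ∈ inflatedIrr N → g ∈ charKer ψ) ∧ (ψ ∉ inflatedIrr N → ψ g = 0) := by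
  rw [sub_dotProduct, (Irr.isClassFunction hψ).uniformDensity_conjugatesOf_dotProduct,
    Irr.mem_inflatedIrr_iff hψ]
  by_cases hN : (N : Set G) ⊆ charKer ψ
  · rw [uniformDensity_dotProduct_of_subset_charKer hN, sub_eq_zero, star_inj, eq_comm]
    exact ⟨fun h => ⟨fun _ => h, fun h' => absurd hN h'⟩, fun h => h.1 hN⟩
  · simp [Irr.uniformDensity_dotProduct_of_not_subset_charKer hψ hN, hN]

theorem isCenterMinusClass_iff_othersTrivialOrVanishAt [Finite G] (hχ : χ ∈ Irr G) :
    IsCenterMinusClass χ g ↔ OthersTrivialOrVanishAt χ g := by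
  have := Fintype.ofFinite G
  refine and_congr_right fun hg => ⟨fun h ψ hψ hne => ?_, fun h => ?_⟩
  · have horth := Irr.dotProduct_star_of_ne hχ hψ hne.symm
    rw [h, smul_dotProduct, smul_eq_zero] at horth
    exact (Irr.uniformDensity_sub_dotProduct_eq_zero_iff hψ _ g).1 <| horth.resolve_left <|
      mul_ne_zero (Irr.apply_one_ne_zero hχ) (natCast_natCard_subgroup_ne_zero _)
  · obtain ⟨t, ht⟩ := ((isClassFunction_uniformDensity_normal (Subgroup.center G)).sub
      (isClassFunction_uniformDensity_conjugatesOf g)).exists_eq_smul hχ fun ψ hψ hne =>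
        (Irr.uniformDensity_sub_dotProduct_eq_zero_iff hψ _ g).2 (h ψ hψ hne)
    have h1 : (Nat.card (Subgroup.center G) : ℂ)⁻¹ = t * χ 1 := by
      have := congrFun ht 1
      rwa [Pi.sub_apply, uniformDensity_of_mem (Subgroup.one_mem _),
        uniformDensity_of_notMem (notMem_conjugatesOf hg (Subgroup.one_mem _)), sub_zero] at this
    rw [ht, smul_smul, mul_right_comm, mul_comm (χ 1), ← h1,
      inv_mul_cancel₀ (natCast_natCard_subgroup_ne_zero _), one_smul]

end CenterMinusClass

section FiniteGroup

variable {G : Type*} [Group G]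

theorem dvd_of_isIntegral_natCast_div {a b : ℕ} (hb : b ≠ 0)
    (h : IsIntegral ℤ ((a : ℂ) / b)) : b ∣ a := by
  have hq : IsIntegral ℤ ((a : ℚ) / b) := by
    rwa [← isIntegral_algebraMap_iff (B := ℂ) (algebraMap ℚ ℂ).injective, map_div₀, map_natCast,
      map_natCast]
  obtain ⟨n, hn⟩ := IsIntegrallyClosed.isIntegral_iff.1 hq
  rw [eq_div_iff (Nat.cast_ne_zero.2 hb), eq_intCast] at hn
  exact Int.natCast_dvd_natCast.1 ⟨n, by rw [mul_comm]; exact_mod_cast hn.symm⟩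

theorem sum_subgroup_eq_card_mul {R : Subgroup G} [Fintype R] {N : Subgroup G} {f : G → ℂ} {c : ℂ}
    (hN : ∀ x ∈ N, f x = c) (hR : ∀ x ∈ R, x ∉ N → f x = 0) :
    ∑ x : R, f x = Nat.card (N.subgroupOf R) * c := by
  classical
  have hf : ∀ x : R, f x = if x ∈ N.subgroupOf R then c else 0 := fun x => by
    split_ifs with hx
    · exact hN x hx
    · exact hR x x.2 hx
  rw [Fintype.sum_congr _ _ hf, ← Finset.sum_filter, Finset.sum_const, nsmul_eq_mul,
    Nat.card_eq_fintype_card, Fintype.card_subtype]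

theorem mem_commutator_of_forall_apply_eq_one [Finite G] {x : G}
    (h : ∀ f : G →* ℂˣ, f x = 1) :
    x ∈ commutator G := by
  by_contra hx
  have hne : Abelianization.of x ≠ 1 := by
    rwa [Ne, ← MonoidHom.mem_ker, Abelianization.ker_of]
  have : Finite (Abelianization G) := inferInstanceAs (Finite (G ⧸ _))
  obtain ⟨f, hf⟩ :=
    CommGroup.exists_apply_ne_one_of_hasEnoughRootsOfUnity (Abelianization G) ℂ hne
  exact hf (h (f.comp Abelianization.of))

theorem isUniqueMinimalNormal_map_mk' {N M : Subgroup G} [N.Normal] [M.Normal] (hlt : N < M)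
    (hM : ∀ L : Subgroup G, L.Normal → N < L → M ≤ L) :
    IsUniqueMinimalNormal (M.map (QuotientGroup.mk' N)) := by
  have hnormal : (M.map (QuotientGroup.mk' N)).Normal :=
    Subgroup.Normal.map ‹_› _ (QuotientGroup.mk'_surjective N)
  have hne : M.map (QuotientGroup.mk' N) ≠ ⊥ := by
    rw [Ne, Subgroup.map_eq_bot_iff, QuotientGroup.ker_mk']
    exact hlt.not_ge
  have hle : ∀ K : Subgroup (G ⧸ N), K.Normal → K ≠ ⊥ → M.map (QuotientGroup.mk' N) ≤ K := by
    intro K hK hKne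
    refine Subgroup.map_le_iff_le_comap.2 (hM _ (hK.comap _) (lt_of_le_of_ne ?_ fun h => hKne ?_))
    · exact QuotientGroup.le_comap_mk' N K
    · rw [← Subgroup.map_comap_eq_self_of_surjective (QuotientGroup.mk'_surjective N) K, ← h,
        QuotientGroup.map_mk'_self]
  exact ⟨⟨⟨hnormal, hne⟩, fun K hK _ => hle K hK.1 hK.2⟩, fun K hK =>
    le_antisymm (hK.2 ⟨hnormal, hne⟩ (hle K hK.1.1 hK.1.2)) (hle K hK.1.1 hK.1.2)⟩

theorem natCard_conjugatesOf_mul_natCard_centralizer (g : G) :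
    Nat.card (conjugatesOf g) * Nat.card (Subgroup.centralizer {g}) = Nat.card G := by
  have : conjugatesOf g = MulAction.orbit (ConjAct G) g := by
    ext x
    rw [ConjAct.mem_orbit_conjAct]
    exact isConj_comm
  rw [Subgroup.nat_card_centralizer_nat_card_stabilizer, this, Nat.card_coe_set_eq,
    ← MulAction.index_stabilizer, Subgroup.index_mul_card]
  rfl

theorem preimage_mk_conjugatesOf {N : Subgroup G} [N.Normal] {g : G}
    (hg : ∀ n ∈ N, IsConj g (n * g)) :
    ((↑) : G → G ⧸ N) ⁻¹' conjugatesOf (g : G ⧸ N) = conjugatesOf g := by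
  refine Set.Subset.antisymm (fun x hx => ?_) fun x hx => (QuotientGroup.mk' N).map_isConj hx
  obtain ⟨c, hc⟩ := isConj_iff.1 hx
  obtain ⟨c, rfl⟩ := QuotientGroup.mk_surjective c
  have hn : c⁻¹ * x * c * g⁻¹ ∈ N := by
    rw [← QuotientGroup.eq_one_iff]
    simp only [QuotientGroup.mk_mul, QuotientGroup.mk_inv, ← hc]
    group
  exact (hg _ hn).trans (isConj_iff.2 ⟨c, by group⟩)

theorem natCard_centralizer_mk [Finite G] {N : Subgroup G} [N.Normal] {g : G}
    (hg : ∀ n ∈ N, IsConj g (n * g)) :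
    Nat.card (Subgroup.centralizer {g}) = Nat.card (Subgroup.centralizer {(g : G ⧸ N)}) := by
  have hclass : Nat.card (conjugatesOf g) =
      Nat.card N * Nat.card (conjugatesOf (g : G ⧸ N)) := by
    rw [← preimage_mk_conjugatesOf hg, QuotientGroup.card_preimage_mk]
  refine Nat.eq_of_mul_eq_mul_left (natCard_conjugatesOf_pos g) ?_
  rw [natCard_conjugatesOf_mul_natCard_centralizer, hclass, mul_assoc,
    natCard_conjugatesOf_mul_natCard_centralizer, mul_comm,
    ← Subgroup.card_eq_card_quotient_mul_card_subgroup]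

theorem exists_prime_forall_pow_eq_one {N : Subgroup G} [Finite N] {y : G} (hy : y ≠ 1)
    (hyN : y ∈ N) (hN : ∀ x ∈ N, x ≠ 1 → IsConj y x) :
    ∃ p : ℕ, p.Prime ∧ ∀ x ∈ N, x ^ p = 1 := by
  have hord : orderOf y ≠ 0 := by
    rw [← Subgroup.orderOf_mk y hyN]
    exact (orderOf_pos _).ne'
  have hp := Nat.minFac_prime (orderOf_eq_one_iff.not.2 hy)
  have hpow : ∀ x ∈ N, ∀ z ∈ N, x ≠ 1 → z ≠ 1 → ∀ n : ℕ, x ^ n = 1 → z ^ n = 1 := by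
    intro x hx z hz hx1 hz1 n h
    rw [← isConj_one_right, ← h]
    exact ((hN x hx hx1).symm.trans (hN z hz hz1)).pow n
  set p := (orderOf y).minFac
  have hordp : orderOf (y ^ (orderOf y / p)) = p :=
    orderOf_pow_orderOf_div hord (Nat.minFac_dvd _)
  refine ⟨p, hp, fun x hx => ?_⟩
  rcases eq_or_ne x 1 with rfl | hx1
  · exact one_pow p
  · refine hpow _ (pow_mem hyN (orderOf y / p)) x hx (fun h => hp.ne_one ?_) hx1 p ?_
    · rw [← hordp, h, orderOf_one]
    · exact orderOf_dvd_iff_pow_eq_one.1 hordp.dvd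

end FiniteGroup

section Consequences

variable {G : Type*} [Group G] [Finite G] {χ ψ : G → ℂ} {g : G}

theorem Irr.sup_normalClosure_subset_charKer (hψ : ψ ∈ Irr G) {N : Subgroup G}
    (hN : (N : Set G) ⊆ charKer ψ) (hg : g ∈ charKer ψ) :
    (↑(N ⊔ Subgroup.normalClosure {g}) : Set G) ⊆ charKer ψ := by
  obtain ⟨K, hK, hKψ, -⟩ := Irr.exists_normal_eq_charKer hψ
  rw [← hKψ] at hN hg ⊢
  exact SetLike.coe_subset_coe.2 <| sup_le hN <|
    Subgroup.normalClosure_le_normal (Set.singleton_subset_iff.2 hg)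

namespace IsCenterMinusClass

theorem exists_natCast_eq (h : IsCenterMinusClass χ g) (hχ : χ ∈ Irr G) :
    ∃ d m : ℕ, 0 < d ∧ 0 < m ∧ χ 1 = d ∧ χ g = -m ∧
      Nat.card (Subgroup.center G) * d = Nat.card (conjugatesOf g) * m := by
  obtain ⟨d, hd, hd1⟩ := Irr.exists_natCast_eq_apply_one hχ
  have hcl := natCast_natCard_conjugatesOf_ne_zero g
  have hg := h.apply_of_isConj (IsConj.refl g)
  rw [hd1, ← Nat.cast_mul] at hg
  have hint := (Irr.isIntegral_apply hχ g).neg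
  rw [hg, neg_neg] at hint
  obtain ⟨m, hm⟩ := dvd_of_isIntegral_natCast_div (Nat.cast_ne_zero.1 hcl) hint
  refine ⟨d, m, hd, Nat.pos_of_ne_zero ?_, hd1, ?_, hm⟩
  · rintro rfl
    exact (Nat.mul_pos Nat.card_pos hd).ne' hm
  · rw [hg, hm, Nat.cast_mul, mul_div_cancel_left₀ _ hcl]

theorem center_eq_charKer (h : IsCenterMinusClass χ g) (hχ : χ ∈ Irr G) :
    (Subgroup.center G : Set G) = charKer χ := by
  refine Set.Subset.antisymm (fun x => h.apply_of_mem_center) fun x hx => ?_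
  by_contra hxZ
  by_cases hgx : IsConj g x
  · obtain ⟨d, m, hd, -, hd1, hgm, -⟩ := h.exists_natCast_eq hχ
    have hsum : (d : ℂ) + m = 0 := by
      rw [← hd1, ← hx.out, ← Irr.isClassFunction hχ hgx, hgm, neg_add_cancel]
    have : d + m = 0 := by exact_mod_cast hsum
    omega
  · exact Irr.apply_one_ne_zero hχ (hx.out.symm.trans (h.apply_eq_zero hxZ hgx))

/-- Otherwise `χ` vanishes on `L \ Z(G)`, so its sum over `L` is positive, whereas it is zero
because `L` is not contained in `ker χ`. -/
theorem mem_of_not_le_center (h : IsCenterMinusClass χ g) (hχ : χ ∈ Irr G) {L : Subgroup G}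
    [L.Normal] (hL : ¬ L ≤ Subgroup.center G) : g ∈ L := by
  have := Fintype.ofFinite L
  by_contra hg
  have hker : ¬ (L : Set G) ⊆ charKer χ := by rwa [← h.center_eq_charKer hχ]
  have hsum : ∑ x : L, χ x = Nat.card ((Subgroup.center G).subgroupOf L) * χ 1 :=
    sum_subgroup_eq_card_mul (fun x => h.apply_of_mem_center) fun x hx hxZ =>
      h.apply_eq_zero hxZ fun hgx => notMem_conjugatesOf hg hx hgx
  rw [Irr.sum_subgroup_eq_zero hχ L hker, zero_eq_mul] at hsum
  exact hsum.elim (Nat.cast_ne_zero.2 Nat.card_pos.ne') (Irr.apply_one_ne_zero hχ)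

/-- A linear character is not `χ` and does not vanish at `g`, so by (2) it is trivial on `Z(G)`
and at `g`. -/
theorem center_lt_commutator (h : IsCenterMinusClass χ g) (hχ : χ ∈ Irr G) (h1 : χ 1 ≠ 1) :
    Subgroup.center G < commutator G := by
  have hlinear (f : G →* ℂˣ) :
      (Subgroup.center G : Set G) ⊆ charKer (fun x => (f x : ℂ)) ∧ f g = 1 := by
    have hf := Irr.coe_monoidHom_mem f
    have hne : (fun x => (f x : ℂ)) ≠ χ := fun hfχ => h1 (by simp [← hfχ])
    have hothers := ((isCenterMinusClass_iff_othersTrivialOrVanishAt hχ).1 h).2 _ hf hne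
    have hmem : (fun x => (f x : ℂ)) ∈ inflatedIrr (Subgroup.center G) :=
      by_contra fun hmem => (f g).ne_zero (hothers.2 hmem)
    exact ⟨(Irr.mem_inflatedIrr_iff hf _).1 hmem, by simpa [charKer] using hothers.1 hmem⟩
  refine SetLike.lt_iff_le_and_exists.2 ⟨fun z hz => ?_, g, ?_, h.1⟩
  · exact mem_commutator_of_forall_apply_eq_one fun f => by
      simpa [charKer] using (hlinear f).1 hz
  · exact mem_commutator_of_forall_apply_eq_one fun f => (hlinear f).2

/-- With `M = Z(G) ⊔ ⟪g⟫`, condition (2) makes the uniform density on `M` minus that on `Z(G)`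
a multiple of `χ`; it does not vanish on `M \ Z(G)`. -/
theorem mem_center_sup_normalClosure_iff (h : IsCenterMinusClass χ g) (hχ : χ ∈ Irr G) {x : G} :
    x ∈ Subgroup.center G ⊔ Subgroup.normalClosure {g} ↔ x ∈ Subgroup.center G ∨ IsConj g x := by
  have := Fintype.ofFinite G
  set M := Subgroup.center G ⊔ Subgroup.normalClosure {g}
  have hZM : Subgroup.center G ≤ M := le_sup_left
  have hgM : g ∈ M := le_sup_right (α := Subgroup G) (Subgroup.subset_normalClosure rfl)
  refine ⟨fun hx => or_iff_not_imp_left.2 fun hxZ => ?_,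
    fun hx => hx.elim (hZM ·) (mem_of_isConj · hgM)⟩
  have horth : ∀ ψ ∈ Irr G, ψ ≠ χ →
      (uniformDensity (M : Set G) - uniformDensity (Subgroup.center G : Set G)) ⬝ᵥ star ψ = 0 := by
    intro ψ hψ hne
    rw [sub_dotProduct, sub_eq_zero]
    by_cases hψZ : (Subgroup.center G : Set G) ⊆ charKer ψ
    · have hψg : g ∈ charKer ψ :=
        (((isCenterMinusClass_iff_othersTrivialOrVanishAt hχ).1 h).2 ψ hψ hne).1
          ((Irr.mem_inflatedIrr_iff hψ _).2 hψZ)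
      rw [uniformDensity_dotProduct_of_subset_charKer
          (Irr.sup_normalClosure_subset_charKer hψ hψZ hψg),
        uniformDensity_dotProduct_of_subset_charKer hψZ]
    · rw [Irr.uniformDensity_dotProduct_of_not_subset_charKer hψ hψZ,
        Irr.uniformDensity_dotProduct_of_not_subset_charKer hψ fun hψM => hψZ (hψM.trans' hZM)]
  obtain ⟨t, ht⟩ := ((isClassFunction_uniformDensity_normal M).sub
    (isClassFunction_uniformDensity_normal (Subgroup.center G))).exists_eq_smul hχ horth
  by_contra hgx
  have hMx := congrFun ht x
  rw [Pi.sub_apply, uniformDensity_subgroup_of_mem hx, uniformDensity_of_notMem hxZ, sub_zero,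
    Pi.smul_apply, h.apply_eq_zero hxZ hgx, smul_zero] at hMx
  exact inv_ne_zero (natCast_natCard_subgroup_ne_zero M) hMx

theorem isConj_mul_of_mem_center (h : IsCenterMinusClass χ g) (hχ : χ ∈ Irr G) {z : G}
    (hz : z ∈ Subgroup.center G) : IsConj g (z * g) := by
  have hzg : χ (z * g) = χ g := by
    obtain ⟨K, -, hK, hmul⟩ := Irr.exists_normal_eq_charKer hχ
    rw [← h.center_eq_charKer hχ, SetLike.coe_set_eq] at hK
    exact hmul z (hK ▸ hz) g
  by_contra hgz
  refine h.apply_ne_zero hχ (hzg ▸ h.apply_eq_zero (fun hzgZ => h.1 ?_) hgz)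
  exact (Subgroup.mul_mem_cancel_left _ hz).1 hzgZ

theorem natCard_center_sup_normalClosure (h : IsCenterMinusClass χ g) (hχ : χ ∈ Irr G) :
    Nat.card (Subgroup.center G ⊔ Subgroup.normalClosure {g} : Subgroup G) =
      Nat.card (Subgroup.center G) + Nat.card (conjugatesOf g) := by
  have hunion : ((Subgroup.center G ⊔ Subgroup.normalClosure {g} : Subgroup G) : Set G) =
      (Subgroup.center G : Set G) ∪ conjugatesOf g :=
    Set.ext fun x => h.mem_center_sup_normalClosure_iff hχ
  rw [← SetLike.coe_sort_coe, hunion, Nat.card_coe_set_eq, Set.ncard_union_eq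
    (Set.disjoint_left.2 fun _ => notMem_conjugatesOf h.1), ← Nat.card_coe_set_eq,
    ← Nat.card_coe_set_eq, SetLike.coe_sort_coe]

/-- The nontrivial elements of `M / Z(G)`, where `M = Z(G) ⊔ ⟪g⟫`, are all conjugate. -/
theorem exists_prime_pow_mem_center (h : IsCenterMinusClass χ g) (hχ : χ ∈ Irr G) :
    ∃ p : ℕ, p.Prime ∧ g ^ p ∈ Subgroup.center G ∧ ∃ a : ℕ,
      Nat.card (Subgroup.center G) + Nat.card (conjugatesOf g) =
        Nat.card (Subgroup.center G) * p ^ a := by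
  set M := Subgroup.center G ⊔ Subgroup.normalClosure {g} with hM
  set π := QuotientGroup.mk' (Subgroup.center G)
  have hgM : π g ∈ M.map π :=
    Subgroup.mem_map_of_mem π ((h.mem_center_sup_normalClosure_iff hχ).2 (.inr (IsConj.refl g)))
  have hconj : ∀ x ∈ M.map π, x ≠ 1 → IsConj (π g) x := by
    rintro _ ⟨x, hx, rfl⟩ hx1
    refine π.map_isConj (((h.mem_center_sup_normalClosure_iff hχ).1 hx).resolve_left ?_)
    exact fun hxZ => hx1 ((QuotientGroup.eq_one_iff x).2 hxZ)
  obtain ⟨p, hp, hpow⟩ := exists_prime_forall_pow_eq_one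
    (fun hg => h.1 ((QuotientGroup.eq_one_iff g).1 hg)) hgM hconj
  have : Fact p.Prime := ⟨hp⟩
  have hpgroup : IsPGroup p (M.map π) := fun x =>
    ⟨1, Subtype.ext (by rw [pow_one]; exact hpow x x.2)⟩
  obtain ⟨a, ha⟩ := IsPGroup.iff_card.1 hpgroup
  refine ⟨p, hp, (QuotientGroup.eq_one_iff _).1 (hpow _ hgM), a, ?_⟩
  rw [← h.natCard_center_sup_normalClosure hχ, ← hM, ← ha, ← Subgroup.relIndex_ker,
    QuotientGroup.ker_mk', ← Subgroup.relIndex_bot_left, ← Subgroup.relIndex_bot_left,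
    Subgroup.relIndex_mul_relIndex _ _ _ bot_le le_sup_left]

theorem natCard_eq (h : IsCenterMinusClass χ g) (hχ : χ ∈ Irr G) {d m : ℕ} (hd : χ 1 = d)
    (hm : χ g = -m) : Nat.card G = Nat.card (Subgroup.center G) * d * (d + m) := by
  have := Fintype.ofFinite G
  have hnorm : (Nat.card G : ℂ) = d * Nat.card (Subgroup.center G) * (d + m) := by
    rw [← Irr.dotProduct_star_self hχ]
    nth_rw 1 [h.2]
    rw [smul_dotProduct, sub_dotProduct,
      uniformDensity_dotProduct_of_subset_charKer (h.center_eq_charKer hχ).subset,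
      (Irr.isClassFunction hχ).uniformDensity_conjugatesOf_dotProduct, hd, hm]
    simp
  rw [mul_comm (Nat.card _) d]
  exact_mod_cast hnorm

/-- An `r`-element conjugate to `g` would have trivial image in `G / Z(G)`, so `χ` vanishes on
`R \ Z(G)`. Hence its sum over `R`, a multiple of `|R|`, equals `|R ∩ Z(G)| χ(1)`. -/
theorem natCard_dvd_of_isPGroup (h : IsCenterMinusClass χ g) (hχ : χ ∈ Irr G) {p r d : ℕ}
    (hpg : g ^ p ∈ Subgroup.center G) (hrp : r.Coprime p) (hd : χ 1 = d) {R : Subgroup G}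
    (hR : IsPGroup r R) : Nat.card R ∣ Nat.card (Subgroup.center G) * d := by
  have := Fintype.ofFinite R
  have hvanish : ∀ x ∈ R, x ∉ Subgroup.center G → χ x = 0 := by
    refine fun x hx hxZ => h.apply_eq_zero hxZ fun hgx => hxZ ?_
    obtain ⟨k, hk⟩ := hR ⟨x, hx⟩
    have hxr : (x : G ⧸ Subgroup.center G) ^ r ^ k = 1 := by
      rw [← QuotientGroup.mk_pow, show x ^ r ^ k = 1 from congrArg Subtype.val hk,
        QuotientGroup.mk_one]
    have hxp : (x : G ⧸ Subgroup.center G) ^ p = 1 :=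
      (QuotientGroup.eq_one_iff (x ^ p)).2 (mem_of_isConj (hgx.pow p) hpg)
    have hx1 := pow_gcd_eq_one.2 ⟨hxr, hxp⟩
    rwa [(hrp.pow_left k).gcd_eq_one, pow_one, QuotientGroup.eq_one_iff] at hx1
  obtain ⟨n, hn⟩ := Irr.exists_natCast_mul_eq_sum_subgroup hχ R
  rw [sum_subgroup_eq_card_mul (fun x => h.apply_of_mem_center) hvanish, hd] at hn
  have hdvd : Nat.card R ∣ Nat.card ((Subgroup.center G).subgroupOf R) * d :=
    ⟨n, by rw [mul_comm (Nat.card R)]; exact_mod_cast hn⟩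
  refine hdvd.trans (mul_dvd_mul_right ?_ d)
  exact Subgroup.card_comap_dvd_of_injective _ _ R.subtype_injective

theorem eq_of_prime_dvd (h : IsCenterMinusClass χ g) (hχ : χ ∈ Irr G) {p r d m : ℕ}
    (hp : p.Prime) (hpg : g ^ p ∈ Subgroup.center G) (hd : χ 1 = d) (hm : χ g = -m)
    (hmd : m ∣ d) (hr : r.Prime) (hrm : r ∣ m) : r = p := by
  by_contra hne
  have : Fact r.Prime := ⟨hr⟩
  let R : Sylow r G := default
  have hR : Nat.card R ∣ Nat.card (Subgroup.center G) * d :=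
    h.natCard_dvd_of_isPGroup hχ hpg ((Nat.coprime_primes hr hp).2 hne) hd R.isPGroup'
  have hrdm : r ∣ d + m := dvd_add (hrm.trans hmd) hrm
  refine Nat.pow_succ_factorization_not_dvd Nat.card_pos.ne' hr (n := Nat.card G) ?_
  rw [pow_succ, ← R.card_eq_multiplicity, h.natCard_eq hχ hd hm]
  exact mul_dvd_mul hR hrdm

/-- With `d = χ(1)` and `m = -χ(g)`, the two counts of `M` and of `G` give `d + m = m pᵃ` and
`|C(g)| = m² pᵃ`. -/
theorem exists_prime_natCard_centralizer (h : IsCenterMinusClass χ g) (hχ : χ ∈ Irr G) :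
    ∃ p : ℕ, p.Prime ∧ (∃ k : ℕ, Nat.card (Subgroup.centralizer {g}) = p ^ k) ∧
      IsPGroup p (Subgroup.center G) := by
  obtain ⟨d, m, -, hm0, hd, hm, hdm⟩ := h.exists_natCast_eq hχ
  obtain ⟨p, hp, hpg, a, ha⟩ := h.exists_prime_pow_mem_center hχ
  have hG := h.natCard_eq hχ hd hm
  have hC := natCard_conjugatesOf_mul_natCard_centralizer g
  have hsum : d + m = m * p ^ a :=
    Nat.eq_of_mul_eq_mul_left (Nat.card_pos (α := Subgroup.center G)) <| by
      linear_combination m * ha + hdm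
  have hcard : Nat.card (Subgroup.centralizer {g}) = m ^ 2 * p ^ a :=
    Nat.eq_of_mul_eq_mul_left (natCard_conjugatesOf_pos g) <| by
      rw [hC, hG, hdm, hsum]
      ring
  have hmd : m ∣ d := (Nat.dvd_add_left dvd_rfl).1 (Dvd.intro _ hsum.symm)
  have hmp : m = p ^ m.primeFactorsList.length :=
    Nat.eq_prime_pow_of_unique_prime_dvd hm0.ne' (h.eq_of_prime_dvd hχ hp hpg hd hm hmd)
  have hpow : ∃ k : ℕ, Nat.card (Subgroup.centralizer {g}) = p ^ k :=
    ⟨_, by rw [hcard, hmp, ← pow_mul, ← pow_add]⟩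
  have hle : Subgroup.center G ≤ Subgroup.centralizer {g} := Subgroup.center_le_centralizer _
  exact ⟨p, hp, hpow, (IsPGroup.of_card hpow.choose_spec).to_le hle⟩

theorem exists_isUniqueMinimalNormal (h : IsCenterMinusClass χ g) (hχ : χ ∈ Irr G) :
    ∃ M : Subgroup G, Subgroup.center G ≤ M ∧
      IsUniqueMinimalNormal (M.map (QuotientGroup.mk' (Subgroup.center G))) ∧
      ∃ c : ConjClasses G, c.carrier = (M : Set G) \ (Subgroup.center G : Set G) := by
  set M := Subgroup.center G ⊔ Subgroup.normalClosure {g}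
  have hgM : g ∈ M := (h.mem_center_sup_normalClosure_iff hχ).2 (.inr (IsConj.refl g))
  have hlt : Subgroup.center G < M := SetLike.lt_iff_le_and_exists.2 ⟨le_sup_left, g, hgM, h.1⟩
  refine ⟨M, le_sup_left, isUniqueMinimalNormal_map_mk' hlt fun L hL hZL => ?_,
    ConjClasses.mk g, Set.ext fun x => ?_⟩
  · exact sup_le hZL.le <| Subgroup.normalClosure_le_normal <| Set.singleton_subset_iff.2 <|
      h.mem_of_not_le_center hχ hZL.not_ge
  · rw [ConjClasses.mem_carrier_iff_mk_eq, ConjClasses.mk_eq_mk_iff_isConj, isConj_comm,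
      Set.mem_sdiff, SetLike.mem_coe, h.mem_center_sup_normalClosure_iff hχ]
    exact ⟨fun hx => ⟨.inr hx, fun hxZ => notMem_conjugatesOf h.1 hxZ hx⟩,
      fun hx => hx.1.resolve_left hx.2⟩

end IsCenterMinusClass

end Consequences

theorem theorem1p6 {G : Type*} [Group G] [Finite G] (χ : G → ℂ) (hχ : χ ∈ Irr G)
    (hnonlinear : χ 1 ≠ 1) :
    ((∃ g : G, VanishesOnNoncentralExcept χ g) ↔
      ((Subgroup.center G : Set G) ⊆ charKer χ ∧ ∃ g : G, OthersTrivialOrVanishAt χ g)) ∧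
    ∀ g : G,
      (VanishesOnNoncentralExcept χ g ∨
        ((Subgroup.center G : Set G) ⊆ charKer χ ∧ OthersTrivialOrVanishAt χ g)) →
      (Subgroup.center G : Set G) = charKer χ ∧
      Subgroup.center G < commutator G ∧
      χ g = -((Nat.card (Subgroup.center G) : ℂ) * χ 1 / (Nat.card (conjugatesOf g) : ℂ)) ∧
      (∃ n : ℤ, χ g = (n : ℂ)) ∧
      Nat.card (Subgroup.centralizer {g}) =
        Nat.card (Subgroup.centralizer {(g : G ⧸ Subgroup.center G)}) ∧
      (∃ p : ℕ, p.Prime ∧ (∃ k : ℕ, Nat.card (Subgroup.centralizer {g}) = p ^ k) ∧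
        IsPGroup p (Subgroup.center G)) ∧
      ∃ M : Subgroup G, Subgroup.center G ≤ M ∧
        IsUniqueMinimalNormal (M.map (QuotientGroup.mk' (Subgroup.center G))) ∧
        ∃ c : ConjClasses G, c.carrier = (M : Set G) \ (Subgroup.center G : Set G) := by
  have hne : χ ≠ 1 := fun h => hnonlinear (by rw [h, Pi.one_apply])
  refine ⟨⟨fun ⟨g, hg⟩ => ?_, fun ⟨_, g, hg⟩ => ⟨g, ?_⟩⟩, fun g hg => ?_⟩
  · have h := hg.isCenterMinusClass hχ hne
    exact ⟨(h.center_eq_charKer hχ).subset, g,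
      (isCenterMinusClass_iff_othersTrivialOrVanishAt hχ).1 h⟩
  · exact ((isCenterMinusClass_iff_othersTrivialOrVanishAt hχ).2 hg).vanishesOnNoncentralExcept hχ
  · have h : IsCenterMinusClass χ g := hg.elim (·.isCenterMinusClass hχ hne)
      fun hg => (isCenterMinusClass_iff_othersTrivialOrVanishAt hχ).2 hg.2
    obtain ⟨d, m, -, -, -, hm, -⟩ := h.exists_natCast_eq hχ
    exact ⟨h.center_eq_charKer hχ, h.center_lt_commutator hχ hnonlinear,
      h.apply_of_isConj (IsConj.refl g), ⟨-m, by rw [hm, Int.cast_neg, Int.cast_natCast]⟩,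
      natCard_centralizer_mk fun z hz => h.isConj_mul_of_mem_center hχ hz,
      h.exists_prime_natCard_centralizer hχ, h.exists_isUniqueMinimalNormal hχ⟩
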